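/- Asymmetric hub model. The nodes are $1,\dots,n$ and the first $n_L\le n$ of them are the leaders. The parameters are a probability vector $\rho=(\rho_1,\dots,\rho_{n_L})$ and a matrix $A\in[0,1]^{n_L\times n}$ with $A_{ii}=1$ for $i\le n_L$. For $t=1,\dots,T$ independently, a hub $z_*^{(t)}\in\{1,\dots,n_L\}$ is drawn with $\mathbb P(z_*^{(t)}=i)=\rho_i$, and given $z_*^{(t)}=i$ the indicators $G^{(t)}_j\in\{0,1\}$, $j=1,\dots,n$, are independent with $\mathbb P(G^{(t)}_j=1\mid z_*^{(t)}=i)=A_{ij}$. For a label vector $z\in\{1,\dots,n_L\}^T$ let $$L_G(A\mid z)=\sum_{t=1}^T\sum_{j=1}^n G^{(t)}_j\log A_{z^{(t)}j}+(1-G^{(t)}_j)\log(1-A_{z^{(t)}j}),\qquad L_G(z)=\max_A L_G(A\mid z),$$ with $\log 0=-\infty$ and $0\log 0=0$, where the maximum is over all $A\in[0,1]^{n_L\times n}$ with $A_{ii}=1$ for $i\le n_L$ (so that $L_G(z)=-\infty$ unless $G^{(t)}_{z^{(t)}}=1$ for all $t$). Let $\hat z$ be any maximizer of $L_G(z)$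 over $z$, and let $T_e=\#\{t: z_*^{(t)}\ne\hat z^{(t)}\}$. Let $n_L$, $n$, $T$ tend to infinity jointly, where $\rho$, $A$, $d>0$ and $v>0$ may vary with them. Suppose that there are positive constants $c_{\min},c_{\max},c_0$, which do not vary, such that (a) $c_{\min}/n_L\le\rho_i\le c_{\max}/n_L$ for all $i\le n_L$; (b) for each $i\le n_L$ there is a set $V_i\subset\{1,\dots,n\}$ with $|V_i|\ge vn/n_L$ and $A_{ij}-A_{i'j}\ge d$ for all $j\in V_i$ and all $i'\ne i$, $i'\le n_L$; (c) $A_{ii'}\le c_0/n_L$ for all $i\ne i'$ with $i,i'\le n_L$. If $$\frac{n_L^2\log n_L}{T}=o(1),\qquad \frac{n_L^3\log T}{d^2vT}=o(1),\qquad \frac{n_L^4\log n_L}{d^4v^2n}=o(1),$$ then $n_LT_e/T=o_p(1)$, that is, $\mathbb P(n_LT_e/T\ge\varepsilon)\to0$ for every $\varepsilon>0$. -/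

import Mathlib

open Filter Topology MeasureTheory

noncomputable section

namespace HubModel

/-- `A` is an admissible parameter matrix of the asymmetric hub model with nodes `Fin n` whose
first `nL` nodes are the leaders: its entries are probabilities, and a hub appears in every group
that it forms (`A i i = 1`, the column of leader `i` being `Fin.castLE h i`). -/
structure IsLinkMatrix {nL n : ℕ} (h : nL ≤ n) (A : Fin nL → Fin n → ℝ) : Prop where
  nonneg : ∀ i j, 0 ≤ A i j
  le_one : ∀ i j, A i j ≤ 1
  hub_mem : ∀ i, A i (Fin.castLE h i) = 1

/-- `ρ` is a probability vector. -/
structure IsHubDistribution {nL : ℕ} (ρ : Fin nL → ℝ) : Prop where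
  nonneg : ∀ i, 0 ≤ ρ i
  sum_eq_one : ∑ i, ρ i = 1

/-- The probability `ℙ(G = g, z⋆ = z | A, ρ)` of the hub labels `z` and the groups `g`: the `T`
pairs are independent, the hub of group `t` is `i` with probability `ρ i`, and given hub `i` the
nodes `j` appear independently with probabilities `A i j`. -/
def jointMass {nL n T : ℕ} (ρ : Fin nL → ℝ) (A : Fin nL → Fin n → ℝ)
    (z : Fin T → Fin nL) (g : Fin T → Fin n → Bool) : ℝ :=
  ∏ t, (ρ (z t) * ∏ j, if g t j then A (z t) j else 1 - A (z t) j)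

/-- The random hub labels `Z` and the random groups `G` on `(Ω, μ)` form a sample of size `T` from
the asymmetric hub model with parameters `ρ` and `A`. -/
structure IsSample {Ω : Type*} [MeasurableSpace Ω] (μ : Measure Ω) {nL n T : ℕ}
    (ρ : Fin nL → ℝ) (A : Fin nL → Fin n → ℝ)
    (Z : Ω → Fin T → Fin nL) (G : Ω → Fin T → Fin n → Bool) : Prop where
  measurable_hubs : Measurable Z
  measurable_groups : Measurable G
  law : ∀ z g, μ {ω | Z ω = z ∧ G ω = g} = ENNReal.ofReal (jointMass ρ A z g)

/-- The logarithm of a probability, with `log 0 = -∞`. -/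
def logProb (p : ℝ) : EReal := ENNReal.log (ENNReal.ofReal p)

/-- The log-likelihood `L_G(A | z)` of the groups `g` given the hub labels `z`, that is
`∑ t, ∑ j, g t j * log A (z t) j + (1 - g t j) * log (1 - A (z t) j)`, where `0 * log 0 = 0`. -/
def logLik {nL n T : ℕ} (g : Fin T → Fin n → Bool) (A : Fin nL → Fin n → ℝ)
    (z : Fin T → Fin nL) : EReal :=
  ∑ t, ∑ j, if g t j then logProb (A (z t) j) else logProb (1 - A (z t) j)

/-- The profile log-likelihood `L_G(z)`: the largest value of `L_G(A | z)` over the admissible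
parameter matrices `A`. It is `-∞` if some group `t` does not contain its label `z t`. -/
def profileLogLik {nL n T : ℕ} (h : nL ≤ n) (g : Fin T → Fin n → Bool)
    (z : Fin T → Fin nL) : EReal :=
  ⨆ A : {A : Fin nL → Fin n → ℝ // IsLinkMatrix h A}, logLik g A.1 z

/-- `zhat` is a maximum profile likelihood estimate of the hub labels of the groups `g`. -/
def IsMaxProfileLik {nL n T : ℕ} (h : nL ≤ n) (g : Fin T → Fin n → Bool)
    (zhat : Fin T → Fin nL) : Prop :=
  ∀ z : Fin T → Fin nL, profileLogLik h g z ≤ profileLogLik h g zhat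

/-- The number `T_e` of groups with an incorrect hub label. -/
def numErrors {nL T : ℕ} (z zhat : Fin T → Fin nL) : ℕ :=
  (Finset.univ.filter fun t => z t ≠ zhat t).card

/-- Every leader `i` has a set of at least `v * n / nL` nodes, each of which prefers groups of hub
`i` to groups of any other hub by a margin of at least `d`. -/
def Separated {nL n : ℕ} (A : Fin nL → Fin n → ℝ) (d v : ℝ) : Prop :=
  ∀ i : Fin nL, ∃ V : Finset (Fin n), v * n / nL ≤ (V.card : ℝ) ∧
    ∀ j ∈ V, ∀ i' : Fin nL, i' ≠ i → d ≤ A i j - A i' j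

end HubModel

end

/-! Write `L` for the number of leaders. Since `A i i = 1`, a label outside its group gives
likelihood zero for every admissible matrix. So a group with hub `k` can be labelled `i ≠ k` only if
leader `i` belongs to it. By Chernoff bounds, with high probability each such pair accounts for at
most order `T / L ^ 2` groups, while every hub forms at least order `T / L` groups. This rules out a
relabelling of the hubs: by `sum_erase_le_two_mul_excess` the errors number at most twice the groups
lying outside the most frequent hub of their label. Groups of different hubs with one label share a
row of fitted parameters, which cannot be close to two separated rows. Hence, whatever the
parameters, the squared distance from the truth is at least `v * n / L * d ^ 2 / 4` per error
(`numErrors_mul_le_sum_sq`).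

On the other hand, fixed labels and parameters at squared distance at least `K` reach the true
likelihood with probability at most `exp (-K / 4)`, by the Bhattacharyya affinity. For given labels
the unconstrained maximizer is a matrix of empirical frequencies, hence one of at most `(T + 1) ^ (n
* L)` grid points. A union bound over labels and grid (`IsSample.measure_exists_lik_le`) costs `L ^
T * (T + 1) ^ (n * L)`. With `ε * T / L` errors, `K / 4` is `ε / 16 * (d ^ 2 * v * n * T / L ^ 2)`,
which beats this entropy under the last two rates. -/

namespace HubModel

open Finset

/-! ### Confusion counts and the distance forced by errors -/

section Deterministic

/-- The number of groups with hub `k` and label `i`. -/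
def confusion {L T : ℕ} (z zh : Fin T → Fin L) (k i : Fin L) : ℝ :=
  ((univ.filter fun t => z t = k ∧ zh t = i).card : ℝ)

lemma confusion_nonneg {L T : ℕ} (z zh : Fin T → Fin L) (k i : Fin L) :
    0 ≤ confusion z zh k i := Nat.cast_nonneg _

lemma sum_eq_sum_confusion {L T : ℕ} (z zh : Fin T → Fin L) (f : Fin L → Fin L → ℝ) :
    ∑ t, f (z t) (zh t) = ∑ i, ∑ k, confusion z zh k i * f k i := by
  have h : ∀ t, f (z t) (zh t) = ∑ i, ∑ k, if z t = k ∧ zh t = i then f k i else 0 := by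
    intro t
    simp only [ite_and]
    simp
  simp_rw [h]
  rw [sum_comm]
  refine sum_congr rfl fun i _ => ?_
  rw [sum_comm]
  refine sum_congr rfl fun k _ => ?_
  rw [← sum_filter, sum_const, nsmul_eq_mul, confusion]

lemma numErrors_eq_sum_confusion {L T : ℕ} (z zh : Fin T → Fin L) :
    (numErrors z zh : ℝ) = ∑ i, ∑ k ∈ univ.erase i, confusion z zh k i := by
  have h := sum_eq_sum_confusion z zh fun k i => if k ≠ i then 1 else 0
  rw [sum_boole] at h
  rw [numErrors, h]
  refine sum_congr rfl fun i _ => ?_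
  simp only [mul_ite, mul_one, mul_zero]
  rw [← sum_filter]
  congr 1
  ext k
  simp

lemma card_eq_sum_confusion {L T : ℕ} (z zh : Fin T → Fin L) (k : Fin L) :
    ((univ.filter fun t => z t = k).card : ℝ) = ∑ i, confusion z zh k i := by
  have h := sum_eq_sum_confusion z zh fun k' _ => if k' = k then 1 else 0
  rw [sum_boole] at h
  rw [h]
  simp

/-- If the off-diagonal entries of a nonnegative matrix `N` are small compared with its row sums,
then the off-diagonal mass is at most twice the mass off the column maxima. -/
lemma sum_erase_le_two_mul_excess {ι : Type*} [Fintype ι] [DecidableEq ι] (N : ι → ι → ℝ)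
    (hN : ∀ k i, 0 ≤ N k i) (κ : ι → ι) {a r : ℝ} (har : 2 * a ≤ r)
    (hoff : ∀ k i, k ≠ i → N k i ≤ a) (hrow : ∀ k, r ≤ ∑ i, N k i) :
    ∑ i, ∑ k ∈ univ.erase i, N k i ≤ 2 * ∑ i, ∑ k ∈ univ.erase (κ i), N k i := by
  set X := ∑ i, ∑ k ∈ univ.erase (κ i), N k i with hX
  set B : Finset ι := univ.filter fun i => κ i ≠ i with hB
  have hsum : ∑ i : ι, (if i ∈ B then a else 0) = (B.card : ℝ) * a := by
    rw [← sum_filter, sum_const, nsmul_eq_mul]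
    simp
  have ha : ∀ i, κ i ≠ i → N (κ i) i ≤ a := fun i hi => hoff _ _ hi
  -- `B` collects the columns whose maximum is off the diagonal. Over the rows in `B`, a column
  -- outside `B` contributes only entries off its maximum; a column in `B` contributes in addition a
  -- maximum of at most `a`.
  have h1 : (B.card : ℝ) * r ≤ X + B.card * a := by
    calc (B.card : ℝ) * r = ∑ k ∈ B, r := by simp
      _ ≤ ∑ k ∈ B, ∑ i, N k i := sum_le_sum fun k _ => hrow k
      _ = ∑ i, ∑ k ∈ B, N k i := sum_comm
      _ ≤ ∑ i, (∑ k ∈ univ.erase (κ i), N k i + if i ∈ B then a else 0) := by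
          refine sum_le_sum fun i _ => ?_
          by_cases hi : κ i = i
          · have : i ∉ B := by simp [hB, hi]
            rw [if_neg this, add_zero]
            refine sum_le_sum_of_subset_of_nonneg ?_ fun k _ _ => hN k i
            intro k hk
            simp only [mem_erase, mem_univ, and_true]
            rintro rfl
            rw [hi] at hk
            exact this hk
          · have : i ∈ B := by simp [hB, hi]
            rw [if_pos this]
            calc ∑ k ∈ B, N k i ≤ ∑ k, N k i :=
                  sum_le_sum_of_subset_of_nonneg (subset_univ _) fun k _ _ => hN k i
              _ = ∑ k ∈ univ.erase (κ i), N k i + N (κ i) i :=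
                  (sum_erase_add _ _ (mem_univ _)).symm
              _ ≤ _ := by linarith [ha i hi]
      _ = X + B.card * a := by rw [sum_add_distrib, hsum]
  have h2 : ∑ i, ∑ k ∈ univ.erase i, N k i ≤ X + B.card * a := by
    calc ∑ i, ∑ k ∈ univ.erase i, N k i
        ≤ ∑ i, (∑ k ∈ univ.erase (κ i), N k i + if i ∈ B then a else 0) := by
          refine sum_le_sum fun i _ => ?_
          by_cases hi : κ i = i
          · have : i ∉ B := by simp [hB, hi]
            rw [if_neg this, add_zero, hi]
          · have : i ∈ B := by simp [hB, hi]
            rw [if_pos this]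
            calc ∑ k ∈ univ.erase i, N k i ≤ ∑ k, N k i :=
                  sum_le_sum_of_subset_of_nonneg (subset_univ _) fun k _ _ => hN k i
              _ = ∑ k ∈ univ.erase (κ i), N k i + N (κ i) i :=
                  (sum_erase_add _ _ (mem_univ _)).symm
              _ ≤ _ := by linarith [ha i hi]
      _ = X + B.card * a := by rw [sum_add_distrib, hsum]
  have hBn : (0 : ℝ) ≤ B.card := Nat.cast_nonneg _
  -- Since `2 * a ≤ r`, `h1` gives `B.card * a ≤ X`, and `h2` then gives `2 * X`.
  nlinarith [mul_le_mul_of_nonneg_left har hBn]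

/-- A weighted sum of squared distances to a common centre is bounded below by the weight off the
heaviest row, if each row has its own set of nodes on which it exceeds the other rows. -/
lemma le_sum_weight_mul_sq {L n : ℕ} {A : Fin L → Fin n → ℝ} {d m : ℝ} (hd : 0 < d)
    {V : Fin L → Finset (Fin n)} (hVm : ∀ k, m ≤ ((V k).card : ℝ))
    (hVd : ∀ k, ∀ j ∈ V k, ∀ k', k' ≠ k → d ≤ A k j - A k' j)
    (w : Fin L → ℝ) (hw : ∀ k, 0 ≤ w k) (κ : Fin L) (hκ : ∀ k, w k ≤ w κ) (b : Fin n → ℝ) :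
    m * d ^ 2 / 2 * ∑ k ∈ univ.erase κ, w k ≤ ∑ k, w k * ∑ j, (A k j - b j) ^ 2 := by
  -- Disjointness lets the bounds for different rows be added without counting a node twice.
  have hdisj : ∀ k k', k ≠ k' → Disjoint (V k) (V k') := by
    intro k k' hkk'
    rw [Finset.disjoint_left]
    intro j hj hj'
    have h1 := hVd k j hj k' hkk'.symm
    have h2 := hVd k' j hj' k hkk'
    linarith
  have hterm : ∀ j, 0 ≤ ∑ k', w k' * (A k' j - b j) ^ 2 := fun j =>
    sum_nonneg fun k' _ => mul_nonneg (hw k') (sq_nonneg _)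
  calc m * d ^ 2 / 2 * ∑ k ∈ univ.erase κ, w k
      = ∑ k ∈ univ.erase κ, m * (w k * (d ^ 2 / 2)) := by
        rw [mul_sum]; exact sum_congr rfl fun k _ => by ring
    _ ≤ ∑ k ∈ univ.erase κ, ∑ j ∈ V k, ∑ k', w k' * (A k' j - b j) ^ 2 := by
        refine sum_le_sum fun k hk => ?_
        have hne : κ ≠ k := (ne_of_mem_erase hk).symm
        calc m * (w k * (d ^ 2 / 2)) ≤ (V k).card * (w k * (d ^ 2 / 2)) :=
              mul_le_mul_of_nonneg_right (hVm k) (mul_nonneg (hw k) (by positivity))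
          _ = ∑ j ∈ V k, w k * (d ^ 2 / 2) := by rw [sum_const, nsmul_eq_mul]
          _ ≤ _ := by
              refine sum_le_sum fun j hj => ?_
              -- Rows `k` and `κ` differ by at least `d` at `j`, so `b j` cannot be close to both;
              -- the heavier row `κ` carries at least the weight `w k`.
              have hs := hVd k j hj κ hne
              have hpair : w k * (A k j - b j) ^ 2 + w κ * (A κ j - b j) ^ 2
                  ≤ ∑ k', w k' * (A k' j - b j) ^ 2 := by
                rw [← sum_pair (f := fun k' => w k' * (A k' j - b j) ^ 2) hne.symm]
                exact sum_le_sum_of_subset_of_nonneg (subset_univ _)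
                  fun k' _ _ => mul_nonneg (hw k') (sq_nonneg _)
              have h1 : w k * (A κ j - b j) ^ 2 ≤ w κ * (A κ j - b j) ^ 2 :=
                mul_le_mul_of_nonneg_right (hκ k) (sq_nonneg _)
              have h2 : d ^ 2 / 2 ≤ (A k j - b j) ^ 2 + (A κ j - b j) ^ 2 := by
                have h3 : d ^ 2 ≤ (A k j - A κ j) ^ 2 := pow_le_pow_left₀ hd.le hs 2
                nlinarith [sq_nonneg ((A k j - b j) + (A κ j - b j))]
              have h4 := mul_le_mul_of_nonneg_left h2 (hw k)
              linarith
    _ = ∑ j ∈ (univ.erase κ).biUnion V, ∑ k', w k' * (A k' j - b j) ^ 2 :=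
        (sum_biUnion fun k _ k' _ h => hdisj k k' h).symm
    _ ≤ ∑ j, ∑ k', w k' * (A k' j - b j) ^ 2 :=
        sum_le_sum_of_subset_of_nonneg (subset_univ _) fun j _ _ => hterm j
    _ = ∑ k, w k * ∑ j, (A k j - b j) ^ 2 := by
        rw [sum_comm]; simp_rw [mul_sum]

/-- A labelling with many errors and few confusions of each pair of hubs is far from the truth for
every choice of the parameters. -/
lemma numErrors_mul_le_sum_sq {L n T : ℕ} {A : Fin L → Fin n → ℝ} {d v : ℝ} (hd : 0 < d)
    (hv : 0 < v) (hsep : Separated A d v) {z zh : Fin T → Fin L} {a r : ℝ} (har : 2 * a ≤ r)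
    (hoff : ∀ k i, k ≠ i → confusion z zh k i ≤ a)
    (hrow : ∀ k, r ≤ ((univ.filter fun t => z t = k).card : ℝ)) (B : Fin L → Fin n → ℝ) :
    v * n / L * d ^ 2 / 4 * numErrors z zh ≤ ∑ t, ∑ j, (A (z t) j - B (zh t) j) ^ 2 := by
  choose V hVm hVd using hsep
  have hκ : ∀ i : Fin L, ∃ κ : Fin L, ∀ k, confusion z zh k i ≤ confusion z zh κ i := by
    intro i
    have : Nonempty (Fin L) := ⟨i⟩
    exact Finite.exists_max fun k => confusion z zh k i
  choose κ hκ using hκ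
  rw [sum_eq_sum_confusion z zh fun k i => ∑ j, (A k j - B i j) ^ 2, numErrors_eq_sum_confusion]
  have h1 := sum_erase_le_two_mul_excess (confusion z zh) (confusion_nonneg z zh) κ har hoff
    fun k => (hrow k).trans_eq (card_eq_sum_confusion z zh k)
  have hc : 0 ≤ v * n / L * d ^ 2 / 4 := by positivity
  calc v * n / L * d ^ 2 / 4 * ∑ i, ∑ k ∈ univ.erase i, confusion z zh k i
      ≤ v * n / L * d ^ 2 / 4 * (2 * ∑ i, ∑ k ∈ univ.erase (κ i), confusion z zh k i) :=
        mul_le_mul_of_nonneg_left h1 hc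
    _ = ∑ i, v * n / L * d ^ 2 / 2 * ∑ k ∈ univ.erase (κ i), confusion z zh k i := by
        rw [← mul_sum]; ring
    _ ≤ _ := sum_le_sum fun i _ => le_sum_weight_mul_sq hd hVm hVd
        (fun k => confusion z zh k i) (fun k => confusion_nonneg z zh k i) (κ i) (hκ i) (B i)

end Deterministic

/-! ### Profile likelihood, the grid of frequencies and the Bernoulli affinity -/

section Likelihood

/-- The likelihood of the groups `g` given the hub labels `z`. -/
def lik {L n T : ℕ} (g : Fin T → Fin n → Bool) (B : Fin L → Fin n → ℝ) (z : Fin T → Fin L) : ℝ :=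
  ∏ t, ∏ j, if g t j then B (z t) j else 1 - B (z t) j

lemma logProb_prod {ι : Type*} (s : Finset ι) (f : ι → ℝ) (hf : ∀ i ∈ s, 0 ≤ f i) :
    logProb (∏ i ∈ s, f i) = ∑ i ∈ s, logProb (f i) := by
  classical
  induction s using Finset.induction with
  | empty => simp [logProb]
  | insert i s hi ih =>
    rw [prod_insert hi, sum_insert hi, ← ih fun k hk => hf k (mem_insert_of_mem hk), logProb,
      ENNReal.ofReal_mul (hf i (mem_insert_self i s)), ENNReal.log_mul_add]
    rfl

lemma bernoulli_nonneg {p : ℝ} (h0 : 0 ≤ p) (h1 : p ≤ 1) (x : Bool) :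
    0 ≤ if x then p else 1 - p := by
  split_ifs <;> linarith

lemma lik_nonneg {L n T : ℕ} (g : Fin T → Fin n → Bool) {B : Fin L → Fin n → ℝ}
    (h0 : ∀ i j, 0 ≤ B i j) (h1 : ∀ i j, B i j ≤ 1) (z : Fin T → Fin L) : 0 ≤ lik g B z :=
  prod_nonneg fun _ _ => prod_nonneg fun _ _ => bernoulli_nonneg (h0 _ _) (h1 _ _) _

lemma logLik_eq_logProb_lik {L n T : ℕ} (g : Fin T → Fin n → Bool) {B : Fin L → Fin n → ℝ}
    (h0 : ∀ i j, 0 ≤ B i j) (h1 : ∀ i j, B i j ≤ 1) (z : Fin T → Fin L) :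
    logLik g B z = logProb (lik g B z) := by
  have h : ∀ t j, 0 ≤ if g t j then B (z t) j else 1 - B (z t) j :=
    fun t j => bernoulli_nonneg (h0 _ _) (h1 _ _) _
  rw [lik, logProb_prod _ _ fun t _ => prod_nonneg fun j _ => h t j, logLik]
  refine sum_congr rfl fun t _ => ?_
  rw [logProb_prod _ _ fun j _ => h t j]
  exact sum_congr rfl fun j _ => by split_ifs <;> rfl

/-- The binomial likelihood is maximal at the empirical frequency. -/
lemma pow_mul_pow_le_frequency (k l : ℕ) {p : ℝ} (h0 : 0 ≤ p) (h1 : p ≤ 1) :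
    p ^ k * (1 - p) ^ l ≤
      ((k : ℝ) / ((k + l : ℕ) : ℝ)) ^ k * (1 - (k : ℝ) / ((k + l : ℕ) : ℝ)) ^ l := by
  rcases Nat.eq_zero_or_pos k with rfl | hk
  · simpa using pow_le_one₀ (n := l) (by linarith : 0 ≤ 1 - p) (by linarith)
  rcases Nat.eq_zero_or_pos l with rfl | hl
  · have : (k : ℝ) ≠ 0 := by positivity
    simpa [this] using pow_le_one₀ (n := k) h0 h1
  have hk' : (0 : ℝ) < k := by exact_mod_cast hk
  have hl' : (0 : ℝ) < l := by exact_mod_cast hl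
  set m : ℝ := k + l with hm
  have hm0 : 0 < m := by positivity
  have hq : 1 - (k : ℝ) / m = l / m := by field_simp; rw [hm]; ring
  push_cast
  rw [← hm, hq]
  have hx : 0 ≤ p / (k / m) := by positivity
  have hy : 0 ≤ (1 - p) / (l / m) := div_nonneg (by linarith) (by positivity)
  -- Weighted AM-GM for the ratios of `p` and `1 - p` to the empirical frequencies, weighted by
  -- these frequencies: the arithmetic mean is `1`. The power `k + l` clears the exponents.
  have amgm := Real.geom_mean_le_arith_mean2_weighted (w₁ := k / m) (w₂ := l / m)
    (by positivity) (by positivity) hx hy (by field_simp; rw [hm])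
  have hone : k / m * (p / (k / m)) + l / m * ((1 - p) / (l / m)) = 1 := by
    field_simp; ring
  rw [hone] at amgm
  have hpow : (p / (k / m)) ^ k * ((1 - p) / (l / m)) ^ l ≤ 1 := by
    have h := pow_le_one₀ (n := k + l) (by positivity) amgm
    refine le_trans (le_of_eq ?_) h
    have e1 : ∀ x : ℝ, 0 ≤ x → ∀ c : ℕ, (x ^ ((c : ℝ) / m)) ^ (k + l) = x ^ c := by
      intro x hx c
      rw [← Real.rpow_natCast, ← Real.rpow_mul hx, ← Real.rpow_natCast]
      congr 1
      push_cast
      rw [← hm]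
      field_simp
    rw [mul_pow, e1 _ hx, e1 _ hy]
  rw [div_pow p, div_pow (1 - p), div_mul_div_comm, div_le_one (by positivity)] at hpow
  exact hpow

/-- The parameters whose entries are the multiples `b i j / #{t | z t = i}`, truncated at `1`. -/
noncomputable def gridMatrix {L n T : ℕ} (z : Fin T → Fin L) (b : Fin L → Fin n → Fin (T + 1)) :
    Fin L → Fin n → ℝ :=
  fun i j => min 1 (((b i j : ℕ) : ℝ) / ((univ.filter fun t => z t = i).card : ℝ))

lemma gridMatrix_nonneg {L n T : ℕ} (z : Fin T → Fin L) (b : Fin L → Fin n → Fin (T + 1)) (i j) :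
    0 ≤ gridMatrix z b i j := le_min zero_le_one (by positivity)

lemma gridMatrix_le_one {L n T : ℕ} (z : Fin T → Fin L) (b : Fin L → Fin n → Fin (T + 1)) (i j) :
    gridMatrix z b i j ≤ 1 := min_le_left _ _

/-- The likelihood with given labels is maximal at a point of the grid. -/
lemma exists_lik_le_lik_gridMatrix {L n T : ℕ} (g : Fin T → Fin n → Bool) (z : Fin T → Fin L) :
    ∃ b : Fin L → Fin n → Fin (T + 1), ∀ B : Fin L → Fin n → ℝ,
      (∀ i j, 0 ≤ B i j) → (∀ i j, B i j ≤ 1) → lik g B z ≤ lik g (gridMatrix z b) z := by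
  set c : Fin L → Fin n → ℕ := fun i j =>
    ((univ.filter fun t => z t = i).filter fun t => g t j = true).card with hc
  set c' : Fin L → Fin n → ℕ := fun i j =>
    ((univ.filter fun t => z t = i).filter fun t => ¬ g t j = true).card with hc'
  have hcc : ∀ i j, c i j + c' i j = (univ.filter fun t => z t = i).card := fun i j =>
    card_filter_add_card_filter_not _
  have hlt : ∀ i j, c i j < T + 1 := fun i j => Nat.lt_succ_of_le <|
    (card_le_univ _).trans_eq (Fintype.card_fin T)
  have hlik : ∀ B : Fin L → Fin n → ℝ, lik g B z =
      ∏ j, ∏ i, B i j ^ c i j * (1 - B i j) ^ c' i j := by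
    intro B
    rw [lik, Finset.prod_comm]
    refine prod_congr rfl fun j _ => ?_
    rw [← prod_fiberwise univ z]
    refine prod_congr rfl fun i _ => ?_
    rw [prod_congr rfl (g := fun t => if g t j = true then B i j else 1 - B i j), prod_ite,
      prod_const, prod_const]
    intro t ht
    rw [(mem_filter.1 ht).2]
  refine ⟨fun i j => ⟨c i j, hlt i j⟩, fun B h0 h1 => ?_⟩
  rw [hlik, hlik]
  have hpos : ∀ i j, 0 ≤ B i j ^ c i j * (1 - B i j) ^ c' i j := fun i j =>
    mul_nonneg (pow_nonneg (h0 i j) _) (pow_nonneg (by linarith [h1 i j]) _)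
  refine prod_le_prod (fun j _ => prod_nonneg fun i _ => hpos i j) fun j _ =>
    prod_le_prod (fun i _ => hpos i j) fun i _ => ?_
  -- A frequency is at most `1`, so the truncation is inactive; for a label without groups both
  -- sides are `0 / 0 = 0`.
  have hmin : gridMatrix z (fun i j => (⟨c i j, hlt i j⟩ : Fin (T + 1))) i j =
      (c i j : ℝ) / ((c i j + c' i j : ℕ) : ℝ) := by
    rw [gridMatrix, hcc i j]
    have hle : c i j ≤ (univ.filter fun t => z t = i).card := card_le_card (filter_subset _ _)
    exact min_eq_right (div_le_one_of_le₀ (Nat.cast_le.2 hle) (Nat.cast_nonneg _))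
  rw [hmin]
  exact pow_mul_pow_le_frequency _ _ (h0 i j) (h1 i j)

/-- If the groups are possible, then a maximum profile likelihood estimate labels each group by one
of its members, and its likelihood is at least the true one at some point of the grid. -/
lemma IsMaxProfileLik.hub_mem_and_lik_le {L n T : ℕ} {h : L ≤ n} {g : Fin T → Fin n → Bool}
    {zh : Fin T → Fin L} (hzh : IsMaxProfileLik h g zh) {A : Fin L → Fin n → ℝ}
    (hA : IsLinkMatrix h A) {z : Fin T → Fin L} (hpos : 0 < lik g A z) :
    (∀ t, g t (Fin.castLE h (zh t)) = true) ∧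
      ∃ b : Fin L → Fin n → Fin (T + 1), lik g A z ≤ lik g (gridMatrix zh b) zh := by
  have hle : logProb (lik g A z) ≤ profileLogLik h g zh := by
    rw [← logLik_eq_logProb_lik g hA.nonneg hA.le_one]
    exact (le_iSup (fun A : {A // IsLinkMatrix h A} => logLik g A.1 z) ⟨A, hA⟩).trans (hzh z)
  have hbot : ⊥ < logProb (lik g A z) := by
    rw [logProb, ENNReal.bot_lt_log_iff]
    exact ENNReal.ofReal_pos.2 hpos
  constructor
  · obtain ⟨⟨B, hB⟩, hlt⟩ := lt_iSup_iff.1 (hbot.trans_le hle)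
    simp only [logLik_eq_logProb_lik g hB.nonneg hB.le_one] at hlt
    rw [logProb, ENNReal.bot_lt_log_iff, ENNReal.ofReal_pos] at hlt
    intro t
    by_contra hg
    -- The absent node is the labelled hub itself, whose factor is `1 - 1 = 0`.
    refine hlt.ne' (prod_eq_zero (mem_univ t) (prod_eq_zero (mem_univ (Fin.castLE h (zh t))) ?_))
    rw [if_neg hg, hB.hub_mem, sub_self]
  · obtain ⟨b, hb⟩ := exists_lik_le_lik_gridMatrix g zh
    refine ⟨b, ?_⟩
    -- The grid point dominates all matrices of probabilities, so it need not itself satisfy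
    -- `hub_mem`.
    have h2 : profileLogLik h g zh ≤ logProb (lik g (gridMatrix zh b) zh) := by
      refine iSup_le fun B => ?_
      rw [logLik_eq_logProb_lik g B.2.nonneg B.2.le_one]
      exact ENNReal.log_monotone
        (ENNReal.ofReal_le_ofReal (hb B.1 B.2.nonneg B.2.le_one))
    have h3 := hle.trans h2
    rw [logProb, logProb, ENNReal.log_le_log_iff] at h3
    exact (ENNReal.ofReal_le_ofReal_iff
      (lik_nonneg g (gridMatrix_nonneg zh b) (gridMatrix_le_one zh b) zh)).1 h3

/-- The Bhattacharyya coefficient of two Bernoulli distributions. -/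
lemma sqrt_mul_add_sqrt_mul_le_exp {a b : ℝ} (ha0 : 0 ≤ a) (ha1 : a ≤ 1) (hb0 : 0 ≤ b)
    (hb1 : b ≤ 1) :
    √(a * b) + √((1 - a) * (1 - b)) ≤ Real.exp (-(a - b) ^ 2 / 4) := by
  -- The right side is `(√x - √y) ^ 2`, and `(x - y) ^ 2` is this times `(√x + √y) ^ 2 ≤ 4`. Used
  -- for `a, b` and for the complements, it bounds the affinity by `1 - (a - b) ^ 2 / 4`.
  have key : ∀ x y : ℝ, 0 ≤ x → x ≤ 1 → 0 ≤ y → y ≤ 1 →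
      (x - y) ^ 2 / 4 ≤ x + y - 2 * √(x * y) := by
    intro x y hx hx1 hy hy1
    rw [Real.sqrt_mul hx]
    have h1 := Real.sq_sqrt hx
    have h2 := Real.sq_sqrt hy
    have h3 : √x ≤ 1 := Real.sqrt_le_one.2 hx1
    have h4 : √y ≤ 1 := Real.sqrt_le_one.2 hy1
    have h5 := Real.sqrt_nonneg x
    have h6 := Real.sqrt_nonneg y
    have h7 : (√x + √y) ^ 2 ≤ 4 := by nlinarith
    have h8 : (x - y) ^ 2 = (√x - √y) ^ 2 * (√x + √y) ^ 2 := by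
      rw [← mul_pow]; congr 1; ring_nf; rw [h1, h2]
    have h9 := mul_le_mul_of_nonneg_left h7 (sq_nonneg (√x - √y))
    rw [h8]
    nlinarith
  have h1 := key a b ha0 ha1 hb0 hb1
  have h2 := key (1 - a) (1 - b) (by linarith) (by linarith) (by linarith) (by linarith)
  have h3 := Real.add_one_le_exp (-(a - b) ^ 2 / 4)
  have h4 : (1 - a - (1 - b)) ^ 2 = (a - b) ^ 2 := by ring
  rw [h4] at h2
  linarith

end Likelihood

/-! ### Chernoff bounds, affinity and the union bound -/

section Probability

lemma jointMass_eq {L n T : ℕ} (ρ : Fin L → ℝ) (A : Fin L → Fin n → ℝ) (z : Fin T → Fin L)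
    (g : Fin T → Fin n → Bool) : jointMass ρ A z g = (∏ t, ρ (z t)) * lik g A z :=
  prod_mul_distrib

lemma jointMass_nonneg {L n T : ℕ} {h : L ≤ n} {ρ : Fin L → ℝ} (hρ : IsHubDistribution ρ)
    {A : Fin L → Fin n → ℝ} (hA : IsLinkMatrix h A) (z : Fin T → Fin L)
    (g : Fin T → Fin n → Bool) : 0 ≤ jointMass ρ A z g := by
  rw [jointMass_eq]
  exact mul_nonneg (prod_nonneg fun t _ => hρ.nonneg _) (lik_nonneg g hA.nonneg hA.le_one z)

/-- The probability of an event is at most the sum of any nonnegative function that dominates the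
joint mass on the event. -/
lemma IsSample.measure_le {Ω : Type*} [MeasurableSpace Ω] {μ : Measure Ω} {L n T : ℕ}
    {ρ : Fin L → ℝ} {A : Fin L → Fin n → ℝ} {Z : Ω → Fin T → Fin L}
    {G : Ω → Fin T → Fin n → Bool} (hs : IsSample μ ρ A Z G)
    (p : (Fin T → Fin L) → (Fin T → Fin n → Bool) → Prop)
    (W : (Fin T → Fin L) → (Fin T → Fin n → Bool) → ℝ) (hW : ∀ z g, 0 ≤ W z g)
    (hpW : ∀ z g, p z g → jointMass ρ A z g ≤ W z g) :
    μ {ω | p (Z ω) (G ω)} ≤ ENNReal.ofReal (∑ z, ∑ g, W z g) := by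
  classical
  set S : Finset ((Fin T → Fin L) × (Fin T → Fin n → Bool)) :=
    univ.filter fun q => p q.1 q.2 with hS
  have hsub : {ω | p (Z ω) (G ω)} ⊆ ⋃ q ∈ S, {ω | Z ω = q.1 ∧ G ω = q.2} := by
    intro ω hω
    simp only [Set.mem_iUnion]
    exact ⟨(Z ω, G ω), by simpa [hS] using hω, rfl, rfl⟩
  calc μ {ω | p (Z ω) (G ω)} ≤ μ (⋃ q ∈ S, {ω | Z ω = q.1 ∧ G ω = q.2}) := measure_mono hsub
    _ ≤ ∑ q ∈ S, μ {ω | Z ω = q.1 ∧ G ω = q.2} := measure_biUnion_finset_le _ _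
    _ ≤ ∑ q ∈ S, ENNReal.ofReal (W q.1 q.2) := by
        refine sum_le_sum fun q hq => ?_
        rw [hs.law]
        exact ENNReal.ofReal_le_ofReal (hpW _ _ (mem_filter.1 hq).2)
    _ = ENNReal.ofReal (∑ q ∈ S, W q.1 q.2) :=
        (ENNReal.ofReal_sum_of_nonneg fun q _ => hW _ _).symm
    _ ≤ ENNReal.ofReal (∑ q : (Fin T → Fin L) × (Fin T → Fin n → Bool), W q.1 q.2) :=
        ENNReal.ofReal_le_ofReal
          (sum_le_sum_of_subset_of_nonneg (subset_univ _) fun q _ _ => hW _ _)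
    _ = _ := by rw [Fintype.sum_prod_type]

/-- The expectation of a product over the groups is a power. -/
lemma sum_jointMass_mul_prod {L n T : ℕ} (ρ : Fin L → ℝ) (A : Fin L → Fin n → ℝ)
    (w : Fin L → (Fin n → Bool) → ℝ) :
    ∑ z : Fin T → Fin L, ∑ g, jointMass ρ A z g * ∏ t, w (z t) (g t) =
      (∑ i, ρ i * ∑ x : Fin n → Bool, (∏ j, if x j then A i j else 1 - A i j) * w i x) ^ T := by
  rw [Fintype.sum_pow]
  refine sum_congr rfl fun z _ => ?_
  rw [prod_mul_distrib, Fintype.prod_sum, mul_sum]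
  refine sum_congr rfl fun g _ => ?_
  rw [jointMass, ← prod_mul_distrib, ← prod_mul_distrib]
  exact prod_congr rfl fun t _ => by ring

lemma sum_prod_bernoulli {n : ℕ} (a : Fin n → ℝ) :
    ∑ x : Fin n → Bool, ∏ j, (if x j then a j else 1 - a j) = 1 := by
  rw [← Fintype.prod_sum fun j (y : Bool) => if y then a j else 1 - a j]
  simp

lemma sum_prod_bernoulli_mul {n : ℕ} (a : Fin n → ℝ) (j : Fin n) :
    ∑ x : Fin n → Bool, (∏ k, (if x k then a k else 1 - a k)) * (if x j then 1 else 0) = a j := by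
  -- The indicator is absorbed into factor `j` by giving weight `0` to the value `false`, so that
  -- the sum still factorizes.
  have h : ∀ x : Fin n → Bool,
      (∏ k, (if x k then a k else 1 - a k)) * (if x j then (1 : ℝ) else 0) =
      ∏ k, (if x k then a k else if k = j then 0 else 1 - a k) := by
    intro x
    cases hx : x j
    · rw [if_neg (by simp), mul_zero]
      exact (prod_eq_zero (mem_univ j) (by simp [hx])).symm
    · rw [if_pos rfl, mul_one]
      refine prod_congr rfl fun k _ => ?_
      by_cases hk : k = j
      · subst hk; simp [hx]
      · simp [hk]
  simp_rw [h]
  rw [← Fintype.prod_sum fun k (y : Bool) => if y then a k else if k = j then 0 else 1 - a k]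
  rw [prod_eq_single j]
  · simp
  · intro k _ hk
    simp [hk]
  · simp

variable {Ω : Type*} [MeasurableSpace Ω] {μ : Measure Ω} {L n T : ℕ} {h : L ≤ n} {ρ : Fin L → ℝ}
  {A : Fin L → Fin n → ℝ} {Z : Ω → Fin T → Fin L} {G : Ω → Fin T → Fin n → Bool}

/-- Chernoff bound for a sum over the groups. -/
lemma IsSample.measure_le_sum_le (hs : IsSample μ ρ A Z G) (hρ : IsHubDistribution ρ)
    (hA : IsLinkMatrix h A) (f : Fin L → (Fin n → Bool) → ℝ) (s q : ℝ)
    (hq : ∑ i, ρ i * ∑ x : Fin n → Bool,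
      (∏ j, if x j then A i j else 1 - A i j) * Real.exp (f i x) ≤ Real.exp q) :
    μ {ω | s ≤ ∑ t, f (Z ω t) (G ω t)} ≤ ENNReal.ofReal (Real.exp (T * q - s)) := by
  refine (hs.measure_le (fun z g => s ≤ ∑ t, f (z t) (g t))
    (fun z g => Real.exp (-s) * (jointMass ρ A z g * ∏ t, Real.exp (f (z t) (g t))))
    (fun z g => by have := jointMass_nonneg hρ hA z g; positivity) ?_).trans ?_
  · intro z g hp
    rw [← Real.exp_sum, mul_left_comm, ← Real.exp_add]
    refine le_mul_of_one_le_right (jointMass_nonneg hρ hA z g) ?_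
    exact Real.one_le_exp (by linarith)
  · refine ENNReal.ofReal_le_ofReal ?_
    simp_rw [← mul_sum]
    rw [sum_jointMass_mul_prod ρ A fun i x => Real.exp (f i x)]
    rw [sub_eq_neg_add, Real.exp_add, Real.exp_nat_mul]
    refine mul_le_mul_of_nonneg_left (pow_le_pow_left₀ ?_ hq _) (Real.exp_pos _).le
    refine sum_nonneg fun i _ => mul_nonneg (hρ.nonneg i) (sum_nonneg fun x _ => ?_)
    exact mul_nonneg (prod_nonneg fun j _ => bernoulli_nonneg (hA.nonneg _ _) (hA.le_one _ _) _)
      (Real.exp_pos _).le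

lemma IsSample.measure_card_hub_le (hs : IsSample μ ρ A Z G) (hρ : IsHubDistribution ρ)
    (hA : IsLinkMatrix h A) (k : Fin L) (s : ℝ) :
    μ {ω | ((univ.filter fun t => Z ω t = k).card : ℝ) ≤ s} ≤
      ENNReal.ofReal (Real.exp (s - T * (ρ k / 2))) := by
  have key := hs.measure_le_sum_le hρ hA (fun i _ => if i = k then -1 else 0) (-s) (-(ρ k / 2)) ?_
  · refine (measure_mono ?_).trans (key.trans_eq ?_)
    · intro ω hω
      simp only [Set.mem_ofPred_eq] at hω ⊢
      rw [← sum_filter, sum_const, nsmul_eq_mul]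
      linarith
    · congr 2; ring
  · have h1 : ∀ i, ρ i * ∑ x : Fin n → Bool, (∏ j, if x j then A i j else 1 - A i j) *
        Real.exp (if i = k then -1 else 0) =
        ρ i + if i = k then ρ i * (Real.exp (-1) - 1) else 0 := by
      intro i
      rw [← sum_mul, sum_prod_bernoulli, one_mul]
      split_ifs
      · ring
      · simp
    simp_rw [h1]
    rw [sum_add_distrib, hρ.sum_eq_one, sum_ite_eq' univ k, if_pos (mem_univ k)]
    -- The moment generating function is `1 + ρ k * (exp (-1) - 1) ≤ 1 - ρ k / 2 ≤ exp (-(ρ k /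
    -- 2))`.
    have h2 : Real.exp (-1) ≤ 1 / 2 := by
      have := Real.exp_neg_one_lt_d9
      norm_num at this ⊢
      linarith
    have h3 := Real.add_one_le_exp (-(ρ k / 2))
    nlinarith [hρ.nonneg k]

lemma IsSample.measure_le_card_hub_and_mem (hs : IsSample μ ρ A Z G) (hρ : IsHubDistribution ρ)
    (hA : IsLinkMatrix h A) (k : Fin L) (j : Fin n) (s : ℝ) :
    μ {ω | s ≤ ((univ.filter fun t => Z ω t = k ∧ G ω t j = true).card : ℝ)} ≤
      ENNReal.ofReal (Real.exp (T * (2 * (ρ k * A k j)) - s)) := by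
  have key := hs.measure_le_sum_le hρ hA (fun i x => if i = k ∧ x j = true then 1 else 0) s
    (2 * (ρ k * A k j)) ?_
  · refine (measure_mono ?_).trans key
    intro ω hω
    simp only [Set.mem_ofPred_eq] at hω ⊢
    rw [sum_boole]
    exact hω
  · have h0 : ∀ (i : Fin L) (x : Fin n → Bool),
        (∏ j, if x j then A i j else 1 - A i j) *
          Real.exp (if i = k ∧ x j = true then 1 else 0) =
        (∏ j, if x j then A i j else 1 - A i j) + (if i = k then Real.exp 1 - 1 else 0) *
          ((∏ j, if x j then A i j else 1 - A i j) * if x j then 1 else 0) := by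
      intro i x
      by_cases h1 : i = k <;> by_cases h2 : x j = true <;> (simp [h1, h2]; try ring)
    have h1 : ∀ i, ρ i * ∑ x : Fin n → Bool, (∏ j, if x j then A i j else 1 - A i j) *
        Real.exp (if i = k ∧ x j = true then 1 else 0) =
        ρ i + if i = k then ρ i * A i j * (Real.exp 1 - 1) else 0 := by
      intro i
      simp_rw [h0]
      rw [sum_add_distrib, sum_prod_bernoulli, ← mul_sum, sum_prod_bernoulli_mul]
      split_ifs <;> ring
    simp_rw [h1]
    rw [sum_add_distrib, hρ.sum_eq_one, sum_ite_eq' univ k, if_pos (mem_univ k)]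
    -- Here it is `1 + ρ k * A k j * (exp 1 - 1)`, and `exp 1 - 1 ≤ 2`.
    have h2 : Real.exp 1 ≤ 3 := by linarith [Real.exp_one_lt_d9]
    have h3 := Real.add_one_le_exp (2 * (ρ k * A k j))
    nlinarith [mul_nonneg (hρ.nonneg k) (hA.nonneg k j)]

/-- The affinity of the laws of the groups under two choices of parameters and labels. -/
lemma sum_sqrt_lik_mul_lik_le {A B : Fin L → Fin n → ℝ} (hA0 : ∀ i j, 0 ≤ A i j)
    (hA1 : ∀ i j, A i j ≤ 1) (hB0 : ∀ i j, 0 ≤ B i j) (hB1 : ∀ i j, B i j ≤ 1)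
    (z zh : Fin T → Fin L) :
    ∑ g, √(lik g A z * lik g B zh) ≤
      Real.exp (-(∑ t, ∑ j, (A (z t) j - B (zh t) j) ^ 2) / 4) := by
  set F : Fin T → Fin n → Bool → ℝ := fun t j y =>
    (if y then A (z t) j else 1 - A (z t) j) * (if y then B (zh t) j else 1 - B (zh t) j) with hF
  have hF0 : ∀ t j y, 0 ≤ F t j y := fun t j y =>
    mul_nonneg (bernoulli_nonneg (hA0 _ _) (hA1 _ _) _) (bernoulli_nonneg (hB0 _ _) (hB1 _ _) _)
  have h1 : ∀ g : Fin T → Fin n → Bool, √(lik g A z * lik g B zh) = ∏ t, ∏ j, √(F t j (g t j)) := by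
    intro g
    have h : lik g A z * lik g B zh = ∏ t, ∏ j, F t j (g t j) := by
      simp_rw [lik, ← prod_mul_distrib, hF]
    rw [h, Real.sqrt_prod _ fun t _ => prod_nonneg fun j _ => hF0 _ _ _]
    exact prod_congr rfl fun t _ => Real.sqrt_prod _ fun j _ => hF0 _ _ _
  simp_rw [h1]
  rw [← Fintype.prod_sum fun t (x : Fin n → Bool) => ∏ j, √(F t j (x j))]
  rw [neg_div, sum_div, ← sum_neg_distrib, Real.exp_sum]
  refine prod_le_prod (fun t _ => sum_nonneg fun x _ => prod_nonneg fun j _ => Real.sqrt_nonneg _)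
    fun t _ => ?_
  rw [← Fintype.prod_sum fun j (y : Bool) => √(F t j y)]
  rw [sum_div, ← sum_neg_distrib, Real.exp_sum]
  refine prod_le_prod (fun j _ => sum_nonneg fun x _ => Real.sqrt_nonneg _) fun j _ => ?_
  rw [Fintype.sum_bool, ← neg_div]
  simpa [hF] using sqrt_mul_add_sqrt_mul_le_exp (hA0 (z t) j) (hA1 (z t) j) (hB0 (zh t) j)
    (hB1 (zh t) j)

lemma IsSample.measure_lik_eq_zero (hs : IsSample μ ρ A Z G) :
    μ {ω | lik (G ω) A (Z ω) = 0} = 0 := by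
  have key := hs.measure_le (fun z g => lik g A z = 0) (fun _ _ => 0) (fun _ _ => le_rfl)
    fun z g hp => by rw [jointMass_eq, hp, mul_zero]
  simpa using key

/-- It is unlikely that some labels and some parameters of the grid that are at squared distance at
least `K` from the truth have at least the true likelihood. -/
lemma IsSample.measure_exists_lik_le (hs : IsSample μ ρ A Z G) (hρ : IsHubDistribution ρ)
    (hA : IsLinkMatrix h A) (K : ℝ) :
    μ {ω | ∃ (zh : Fin T → Fin L) (b : Fin L → Fin n → Fin (T + 1)),
        K ≤ ∑ t, ∑ j, (A (Z ω t) j - gridMatrix zh b (zh t) j) ^ 2 ∧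
          lik (G ω) A (Z ω) ≤ lik (G ω) (gridMatrix zh b) zh} ≤
      ENNReal.ofReal ((L : ℝ) ^ T * ((T : ℝ) + 1) ^ (n * L) * Real.exp (-K / 4)) := by
  classical
  set D : (Fin T → Fin L) → (Fin T → Fin L) → (Fin L → Fin n → Fin (T + 1)) → ℝ :=
    fun z zh b => ∑ t, ∑ j, (A (z t) j - gridMatrix zh b (zh t) j) ^ 2 with hD
  -- Whenever some candidate reaches the true likelihood, the latter is at most the geometric mean
  -- of the two. Summing these means over all distant candidates dominates the joint mass and allows
  -- candidates that depend on the data.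
  set W : (Fin T → Fin L) → (Fin T → Fin n → Bool) → ℝ := fun z g => (∏ t, ρ (z t)) *
    ∑ zh, ∑ b, if K ≤ D z zh b then √(lik g A z * lik g (gridMatrix zh b) zh) else 0 with hW
  have hρ0 : ∀ z : Fin T → Fin L, 0 ≤ ∏ t, ρ (z t) := fun z => prod_nonneg fun t _ => hρ.nonneg _
  have hterm : ∀ z g zh b, 0 ≤
      if K ≤ D z zh b then √(lik g A z * lik g (gridMatrix zh b) zh) else 0 := by
    intro z g zh b
    split_ifs
    · exact Real.sqrt_nonneg _
    · exact le_rfl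
  refine (hs.measure_le (fun z g => ∃ zh b, K ≤ D z zh b ∧
    lik g A z ≤ lik g (gridMatrix zh b) zh) W (fun z g => mul_nonneg (hρ0 z) (sum_nonneg fun zh _ =>
      sum_nonneg fun b _ => hterm z g zh b)) ?_).trans (ENNReal.ofReal_le_ofReal ?_)
  · rintro z g ⟨zh, b, hK, hl⟩
    rw [jointMass_eq]
    refine mul_le_mul_of_nonneg_left ?_ (hρ0 z)
    have hl0 := lik_nonneg g hA.nonneg hA.le_one z
    calc lik g A z ≤ √(lik g A z * lik g (gridMatrix zh b) zh) :=
          Real.le_sqrt_of_sq_le (by rw [sq]; exact mul_le_mul_of_nonneg_left hl hl0)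
      _ = if K ≤ D z zh b then √(lik g A z * lik g (gridMatrix zh b) zh) else 0 :=
          (if_pos hK).symm
      _ ≤ ∑ b, if K ≤ D z zh b then √(lik g A z * lik g (gridMatrix zh b) zh) else 0 :=
          single_le_sum (f := fun b =>
            if K ≤ D z zh b then √(lik g A z * lik g (gridMatrix zh b) zh) else 0)
            (fun b _ => hterm z g zh b) (mem_univ b)
      _ ≤ _ := single_le_sum (f := fun zh => ∑ b,
            if K ≤ D z zh b then √(lik g A z * lik g (gridMatrix zh b) zh) else 0)
            (fun zh _ => sum_nonneg fun b _ => hterm z g zh b) (mem_univ zh)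
  · have h1 : ∀ z zh b, ∑ g, (if K ≤ D z zh b then √(lik g A z * lik g (gridMatrix zh b) zh)
        else 0) ≤ Real.exp (-K / 4) := by
      intro z zh b
      split_ifs with hK
      · refine (sum_sqrt_lik_mul_lik_le hA.nonneg hA.le_one (gridMatrix_nonneg zh b)
          (gridMatrix_le_one zh b) z zh).trans (Real.exp_le_exp.2 ?_)
        change K ≤ ∑ t, ∑ j, (A (z t) j - gridMatrix zh b (zh t) j) ^ 2 at hK
        linarith
      · rw [sum_const_zero]
        exact (Real.exp_pos _).le
    have h2 : ∑ z : Fin T → Fin L, ∏ t, ρ (z t) = 1 := by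
      rw [← Fintype.sum_pow, hρ.sum_eq_one, one_pow]
    calc ∑ z, ∑ g, W z g
        = ∑ z, (∏ t, ρ (z t)) * ∑ zh, ∑ b, ∑ g,
            (if K ≤ D z zh b then √(lik g A z * lik g (gridMatrix zh b) zh) else 0) := by
          refine sum_congr rfl fun z _ => ?_
          rw [hW, ← mul_sum, sum_comm]
          congr 1
          exact sum_congr rfl fun zh _ => sum_comm
      _ ≤ ∑ z : Fin T → Fin L, (∏ t, ρ (z t)) * ∑ _zh : Fin T → Fin L,
            ∑ _b : Fin L → Fin n → Fin (T + 1), Real.exp (-K / 4) :=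
          sum_le_sum fun z _ => mul_le_mul_of_nonneg_left
            (sum_le_sum fun zh _ => sum_le_sum fun b _ => h1 z zh b) (hρ0 z)
      _ = _ := by
          rw [← sum_mul, h2, one_mul]
          simp only [sum_const, card_univ, Fintype.card_pi, Fintype.card_fin, prod_const,
            nsmul_eq_mul]
          push_cast
          rw [pow_mul]
          ring

/-- The probability that a maximum profile likelihood estimate has at least `M` errors. -/
lemma IsSample.measure_numErrors_ge_le (hs : IsSample μ ρ A Z G) (hρ : IsHubDistribution ρ)
    (hA : IsLinkMatrix h A) {zh : Ω → Fin T → Fin L}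
    (hzh : ∀ᵐ ω ∂μ, IsMaxProfileLik h (G ω) (zh ω)) {d v : ℝ} (hd : 0 < d) (hv : 0 < v)
    (hsep : Separated A d v) {a r p q : ℝ} (har : 2 * a ≤ r) (hp : ∀ k, p ≤ ρ k)
    (hq : ∀ k i, k ≠ i → ρ k * A k (Fin.castLE h i) ≤ q) (M : ℝ) :
    μ {ω | M ≤ numErrors (Z ω) (zh ω)} ≤ ENNReal.ofReal
      (L * Real.exp (r - T * (p / 2)) + L * (L * Real.exp (T * (2 * q) - a)) +
        (L : ℝ) ^ T * ((T : ℝ) + 1) ^ (n * L) *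
          Real.exp (-(v * n / L * d ^ 2 / 4 * M) / 4)) := by
  set K := v * n / L * d ^ 2 / 4 * M with hK
  set E₀ : Set Ω := {ω | ¬ IsMaxProfileLik h (G ω) (zh ω)} with hE₀
  set E₁ : Set Ω := {ω | lik (G ω) A (Z ω) = 0} with hE₁
  set E₂ : Set Ω := ⋃ k, {ω | ((univ.filter fun t => Z ω t = k).card : ℝ) ≤ r} with hE₂
  set E₃ : Set Ω := ⋃ k, ⋃ i, {ω | k ≠ i ∧
    a ≤ ((univ.filter fun t => Z ω t = k ∧ G ω t (Fin.castLE h i) = true).card : ℝ)} with hE₃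
  set E₄ : Set Ω := {ω | ∃ (zh : Fin T → Fin L) (b : Fin L → Fin n → Fin (T + 1)),
        K ≤ ∑ t, ∑ j, (A (Z ω t) j - gridMatrix zh b (zh t) j) ^ 2 ∧
          lik (G ω) A (Z ω) ≤ lik (G ω) (gridMatrix zh b) zh} with hE₄
  -- The bad events: no maximizer, an impossible sample, a rare hub, a leader too often in another
  -- hub's groups, a distant candidate with high likelihood.
  have hsub : {ω | M ≤ numErrors (Z ω) (zh ω)} ⊆ E₀ ∪ E₁ ∪ (E₂ ∪ E₃ ∪ E₄) := by
    intro ω hω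
    by_contra hno
    simp only [Set.mem_union, not_or] at hno
    obtain ⟨⟨h0, h1⟩, ⟨h2, h3⟩, h4⟩ := hno
    have hmax : IsMaxProfileLik h (G ω) (zh ω) := not_not.1 h0
    have hpos : 0 < lik (G ω) A (Z ω) :=
      lt_of_le_of_ne (lik_nonneg _ hA.nonneg hA.le_one _) (Ne.symm h1)
    obtain ⟨hmem, b, hb⟩ := hmax.hub_mem_and_lik_le hA hpos
    refine h4 ⟨zh ω, b, ?_, hb⟩
    have hrow : ∀ k, r ≤ ((univ.filter fun t => Z ω t = k).card : ℝ) := by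
      intro k
      by_contra hlt
      exact h2 (Set.mem_iUnion.2 ⟨k, (not_le.1 hlt).le⟩)
    have hoff : ∀ k i, k ≠ i → confusion (Z ω) (zh ω) k i ≤ a := by
      intro k i hki
      by_contra hlt
      refine h3 (Set.mem_iUnion.2 ⟨k, Set.mem_iUnion.2 ⟨i, hki, (not_le.1 hlt).le.trans ?_⟩⟩)
      refine Nat.cast_le.2 (card_le_card fun t ht => ?_)
      simp only [mem_filter, mem_univ, true_and] at ht ⊢
      exact ⟨ht.1, ht.2 ▸ hmem t⟩
    have hc : 0 ≤ v * n / L * d ^ 2 / 4 := by positivity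
    exact (mul_le_mul_of_nonneg_left hω hc).trans
      (numErrors_mul_le_sum_sq hd hv hsep har hoff hrow (gridMatrix (zh ω) b))
  have b₂ : μ E₂ ≤ ENNReal.ofReal (L * Real.exp (r - T * (p / 2))) := by
    refine (measure_iUnion_fintype_le μ _).trans ?_
    have hhub : ∀ k, μ {ω | ((univ.filter fun t => Z ω t = k).card : ℝ) ≤ r} ≤
        ENNReal.ofReal (Real.exp (r - T * (p / 2))) := by
      intro k
      refine (hs.measure_card_hub_le hρ hA k r).trans
        (ENNReal.ofReal_le_ofReal (Real.exp_le_exp.2 ?_))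
      have := mul_le_mul_of_nonneg_left (hp k) (Nat.cast_nonneg (α := ℝ) T)
      linarith
    refine (sum_le_sum fun k _ => hhub k).trans_eq ?_
    rw [sum_const, card_univ, Fintype.card_fin, nsmul_eq_mul,
      ENNReal.ofReal_mul (Nat.cast_nonneg _), ENNReal.ofReal_natCast]
  have b₃ : μ E₃ ≤ ENNReal.ofReal (L * (L * Real.exp (T * (2 * q) - a))) := by
    have hpair : ∀ k i : Fin L, μ {ω | k ≠ i ∧ a ≤ ((univ.filter fun t =>
        Z ω t = k ∧ G ω t (Fin.castLE h i) = true).card : ℝ)} ≤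
        ENNReal.ofReal (Real.exp (T * (2 * q) - a)) := by
      intro k i
      by_cases hki : k = i
      · simp [hki]
      · refine (measure_mono fun ω hω => hω.2).trans
          ((hs.measure_le_card_hub_and_mem hρ hA k (Fin.castLE h i) a).trans
            (ENNReal.ofReal_le_ofReal (Real.exp_le_exp.2 ?_)))
        have := mul_le_mul_of_nonneg_left (hq k i hki) (Nat.cast_nonneg (α := ℝ) T)
        linarith
    refine (measure_iUnion_fintype_le μ _).trans ?_
    refine (sum_le_sum fun k _ => (measure_iUnion_fintype_le μ _).trans
      (sum_le_sum fun i _ => hpair k i)).trans_eq ?_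
    simp only [sum_const, card_univ, Fintype.card_fin, nsmul_eq_mul]
    rw [ENNReal.ofReal_mul (Nat.cast_nonneg _), ENNReal.ofReal_mul (Nat.cast_nonneg _),
      ENNReal.ofReal_natCast]
  have b₄ := hs.measure_exists_lik_le hρ hA K
  have b₀ : μ E₀ = 0 := hzh
  have b₁ : μ E₁ = 0 := hs.measure_lik_eq_zero
  calc μ {ω | M ≤ numErrors (Z ω) (zh ω)} ≤ μ (E₀ ∪ E₁ ∪ (E₂ ∪ E₃ ∪ E₄)) := measure_mono hsub
    _ ≤ μ E₀ + μ E₁ + (μ E₂ + μ E₃ + μ E₄) :=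
        (measure_union_le _ _).trans (add_le_add (measure_union_le _ _)
          ((measure_union_le _ _).trans (add_le_add (measure_union_le _ _) le_rfl)))
    _ = μ E₂ + μ E₃ + μ E₄ := by rw [b₀, b₁, zero_add, zero_add]
    _ ≤ _ := add_le_add (add_le_add b₂ b₃) b₄
    _ = _ := by
        rw [ENNReal.ofReal_add (by positivity) (by positivity),
          ENNReal.ofReal_add (by positivity) (by positivity)]

end Probability

/-! ### Consequences of the rate conditions -/

section Rates

variable {L T n ε d v : ℝ}

lemma mul_exp_neg_le_inv_of_sq_mul_log_le {c : ℝ} (hL : 1 ≤ L) (hT : 0 < T)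
    (h : L ^ 2 * Real.log L / T ≤ c / 8) :
    L * Real.exp (-(c * T / (4 * L))) ≤ 1 / L := by
  have hL0 : 0 < L := by linarith
  rw [div_le_iff₀ hT] at h
  have h1 : 2 * Real.log L ≤ c * T / (4 * L) := by
    rw [le_div_iff₀ (by positivity)]
    have := Real.log_nonneg hL
    nlinarith [mul_nonneg (mul_nonneg this hL0.le) (sub_nonneg.2 hL)]
  calc L * Real.exp (-(c * T / (4 * L))) ≤ L * Real.exp (-(Real.log L + Real.log L)) := by
        gcongr; linarith
    _ = 1 / L := by
        rw [Real.exp_neg, Real.exp_add, Real.exp_log hL0]; field_simp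

/-- Three logarithms are needed: two for the union over ordered pairs of leaders, one for the
remaining `1 / L`. -/
lemma sq_mul_exp_neg_le_inv_of_sq_mul_log_le (hL : 1 ≤ L) (hT : 0 < T)
    (h : L ^ 2 * Real.log L / T ≤ 1 / 3) :
    L * (L * Real.exp (-(T / L ^ 2))) ≤ 1 / L := by
  have hL0 : 0 < L := by linarith
  rw [div_le_iff₀ hT] at h
  have h1 : 3 * Real.log L ≤ T / L ^ 2 := by
    rw [le_div_iff₀ (by positivity)]
    linarith
  calc L * (L * Real.exp (-(T / L ^ 2)))
      ≤ L * (L * Real.exp (-(Real.log L + Real.log L + Real.log L))) := by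
        gcongr; linarith
    _ = 1 / L := by
        rw [Real.exp_neg, Real.exp_add, Real.exp_add, Real.exp_log hL0]; field_simp

/-- The entropy of the labels and of the grid is negligible compared with the separation. -/
lemma log_entropy_add_le (hL : 1 ≤ L) (hT : 2 ≤ T) (hn : 0 < n) (hd : 0 < d) (hd1 : d ≤ 1)
    (hv : 0 < v) (hvL : v ≤ L) (hε : 0 < ε)
    (h2 : L ^ 3 * Real.log T / (d ^ 2 * v * T) ≤ ε / 96)
    (h3 : L ^ 4 * Real.log L / (d ^ 4 * v ^ 2 * n) ≤ ε / 48) :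
    T * Real.log L + n * L * Real.log (T + 1) - ε / 16 * (d ^ 2 * v * n * T / L ^ 2) ≤
      -Real.log L := by
  have hL0 : 0 < L := by linarith
  have hT0 : 0 < T := by linarith
  have hlL := Real.log_nonneg hL
  -- The exponent `X` is spent in thirds: the labels, the grid, and the final `log L ≤ T * log L`.
  set X := ε / 16 * (d ^ 2 * v * n * T / L ^ 2) with hX
  rw [div_le_iff₀ (by positivity)] at h2 h3
  -- `T + 1 ≤ T ^ 2` because `2 ≤ T`.
  have hlog : Real.log (T + 1) ≤ 2 * Real.log T := by
    rw [← Real.log_rpow hT0]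
    refine Real.log_le_log (by linarith) ?_
    norm_num
    nlinarith
  have e2 : n * L * Real.log (T + 1) ≤ X / 3 := by
    have h : n * L * (2 * Real.log T) ≤ X / 3 := by
      have e : X / 3 = ε / 48 * (d ^ 2 * v * T) * n / L ^ 2 := by rw [hX]; ring
      rw [e, le_div_iff₀ (by positivity)]
      nlinarith [mul_le_mul_of_nonneg_left h2 hn.le]
    exact (mul_le_mul_of_nonneg_left hlog (by positivity)).trans h
  have e3 : T * Real.log L ≤ X / 3 := by
    have hdv : d ^ 2 * v ≤ L ^ 2 := by
      calc d ^ 2 * v ≤ 1 * L := mul_le_mul (pow_le_one₀ hd.le hd1) hvL hv.le zero_le_one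
        _ ≤ L ^ 2 := by nlinarith
    have e : X / 3 = ε / 48 * (d ^ 2 * v * n * T) * L ^ 2 / L ^ 4 := by
      rw [hX]; field_simp; ring
    rw [e, le_div_iff₀ (by positivity)]
    calc T * Real.log L * L ^ 4 = T * (L ^ 4 * Real.log L) := by ring
      _ ≤ T * (ε / 48 * (d ^ 4 * v ^ 2 * n)) := mul_le_mul_of_nonneg_left h3 hT0.le
      _ = ε / 48 * (d ^ 2 * v * n * T) * (d ^ 2 * v) := by ring
      _ ≤ _ := mul_le_mul_of_nonneg_left hdv (by positivity)
  nlinarith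

end Rates

/-! ### The nonasymptotic bound and the limit -/

/-- These bounds yield `d ^ 2 * v ≤ L ^ 2` in `log_entropy_add_le`. A second leader is needed for `d
≤ 1`: the margin is a difference of two probabilities at a node of a nonempty set. -/
lemma Separated.margin_le_one {L n : ℕ} {h : L ≤ n} {A : Fin L → Fin n → ℝ}
    (hA : IsLinkMatrix h A) {d v : ℝ} (hv : 0 < v) (hsep : Separated A d v) (hL : 2 ≤ L) :
    d ≤ 1 ∧ v ≤ L := by
  obtain ⟨V, hV, hVd⟩ := hsep ⟨0, by omega⟩
  have hL0 : (0 : ℝ) < L := by exact_mod_cast (by omega : 0 < L)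
  have hn0 : (0 : ℝ) < n := by exact_mod_cast (by omega : 0 < n)
  constructor
  · have hpos : (0 : ℝ) < V.card := lt_of_lt_of_le (by positivity) hV
    obtain ⟨j, hj⟩ := card_pos.1 (by exact_mod_cast hpos : 0 < V.card)
    have h1 := hVd j hj ⟨1, by omega⟩ (by simp)
    linarith [hA.le_one ⟨0, by omega⟩ j, hA.nonneg ⟨1, by omega⟩ j]
  · have hcard : (V.card : ℝ) ≤ n := by
      exact_mod_cast (card_le_univ V).trans_eq (Fintype.card_fin n)
    have h1 := hV.trans hcard
    rw [div_le_iff₀ hL0, mul_comm] at h1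
    exact le_of_mul_le_mul_left h1 hn0

/-- A nonasymptotic bound on the probability that the proportion of errors is not `o(1 / L)`. -/
lemma IsSample.measure_numErrors_ge_le_three_div {Ω : Type*} [MeasurableSpace Ω] {μ : Measure Ω}
    {L n T : ℕ} {h : L ≤ n} {ρ : Fin L → ℝ} {A : Fin L → Fin n → ℝ} {Z : Ω → Fin T → Fin L}
    {G : Ω → Fin T → Fin n → Bool} (hs : IsSample μ ρ A Z G) (hρ : IsHubDistribution ρ)
    (hA : IsLinkMatrix h A) {zh : Ω → Fin T → Fin L}
    (hzh : ∀ᵐ ω ∂μ, IsMaxProfileLik h (G ω) (zh ω)) {cmin cmax c₀ d v ε : ℝ} (hcmin : 0 < cmin)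
    (hρ_bounds : ∀ i, cmin / (L : ℝ) ≤ ρ i ∧ ρ i ≤ cmax / (L : ℝ)) (hd : 0 < d) (hv : 0 < v)
    (hsep : Separated A d v)
    (hlead : ∀ i i' : Fin L, i ≠ i' → A i (Fin.castLE h i') ≤ c₀ / (L : ℝ)) (hε : 0 < ε)
    (hL : 2 ≤ L) (hLC : 8 * (2 * (cmax * c₀) + 1) / cmin ≤ L) (hT : 2 ≤ T)
    (h1 : (L : ℝ) ^ 2 * Real.log L / T ≤ cmin / 8)
    (h1' : (L : ℝ) ^ 2 * Real.log L / T ≤ 1 / 3)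
    (h2 : (L : ℝ) ^ 3 * Real.log T / (d ^ 2 * v * T) ≤ ε / 96)
    (h3 : (L : ℝ) ^ 4 * Real.log L / (d ^ 4 * v ^ 2 * n) ≤ ε / 48) :
    μ {ω | ε ≤ (L : ℝ) * ((numErrors (Z ω) (zh ω) : ℝ) / T)} ≤ ENNReal.ofReal (3 / L) := by
  have hL2 : (2 : ℝ) ≤ L := by exact_mod_cast hL
  have hT2 : (2 : ℝ) ≤ T := by exact_mod_cast hT
  have hL0 : (0 : ℝ) < L := by linarith
  have hT0 : (0 : ℝ) < T := by linarith
  have hn0 : (0 : ℝ) < n := by exact_mod_cast (by omega : 0 < n)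
  obtain ⟨hd1, hvL⟩ := hsep.margin_le_one hA hv hL
  have hcmax : 0 ≤ cmax / (L : ℝ) := by
    have := hρ_bounds ⟨0, by omega⟩
    exact (hρ.nonneg _).trans this.2
  -- `r` is half the Chernoff threshold `T * p / 2`, and the `+ 1` in `a` leaves `T / L ^ 2` in the
  -- exponent. With these choices `2 * a ≤ r` is exactly `hLC`.
  have key := hs.measure_numErrors_ge_le hρ hA hzh hd hv hsep
    (a := (2 * (cmax * c₀) + 1) * T / L ^ 2) (r := cmin * T / (4 * L)) (p := cmin / L)
    (q := cmax / L * (c₀ / L)) ?_ (fun k => (hρ_bounds k).1)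
    (fun k i hki => mul_le_mul (hρ_bounds k).2 (hlead k i hki) (hA.nonneg _ _) hcmax) (ε * T / L)
  · refine (measure_mono fun ω hω => ?_).trans (key.trans (ENNReal.ofReal_le_ofReal ?_))
    · change ε ≤ (L : ℝ) * ((numErrors (Z ω) (zh ω) : ℝ) / T) at hω
      change ε * T / L ≤ (numErrors (Z ω) (zh ω) : ℝ)
      rw [← mul_div_assoc, le_div_iff₀ hT0] at hω
      rw [div_le_iff₀ hL0]
      linarith
    · have t1 : (L : ℝ) * Real.exp (cmin * T / (4 * L) - T * (cmin / L / 2)) ≤ 1 / L := by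
        rw [show cmin * T / (4 * L) - T * (cmin / L / 2) = -(cmin * T / (4 * (L : ℝ))) by
          field_simp; ring]
        exact mul_exp_neg_le_inv_of_sq_mul_log_le (by linarith) hT0 h1
      have t2 : (L : ℝ) * (L * Real.exp (T * (2 * (cmax / L * (c₀ / L))) -
          (2 * (cmax * c₀) + 1) * T / L ^ 2)) ≤ 1 / L := by
        rw [show T * (2 * (cmax / L * (c₀ / L))) - (2 * (cmax * c₀) + 1) * T / (L : ℝ) ^ 2 =
          -(T / (L : ℝ) ^ 2) by field_simp; ring]
        exact sq_mul_exp_neg_le_inv_of_sq_mul_log_le (by linarith) hT0 h1'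
      have t3 : (L : ℝ) ^ T * ((T : ℝ) + 1) ^ (n * L) *
          Real.exp (-(v * n / L * d ^ 2 / 4 * (ε * T / L)) / 4) ≤ 1 / L := by
        have h4 := log_entropy_add_le (by linarith) hT2 hn0 hd hd1 hv hvL hε h2 h3
        have e1 : (L : ℝ) ^ T = Real.exp (T * Real.log L) := by
          rw [Real.exp_nat_mul, Real.exp_log hL0]
        have e2 : ((T : ℝ) + 1) ^ (n * L) = Real.exp (n * L * Real.log (T + 1)) := by
          rw [← Nat.cast_mul, Real.exp_nat_mul, Real.exp_log (by linarith)]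
        rw [e1, e2, ← Real.exp_add, ← Real.exp_add]
        calc _ ≤ Real.exp (-Real.log L) := by
              refine Real.exp_le_exp.2 (le_trans (le_of_eq ?_) h4)
              field_simp
              ring
          _ = 1 / L := by rw [Real.exp_neg, Real.exp_log hL0, one_div]
      calc _ ≤ 1 / (L : ℝ) + 1 / L + 1 / L := add_le_add (add_le_add t1 t2) t3
        _ = 3 / L := by ring
  · rw [div_le_iff₀ hcmin] at hLC
    rw [← mul_div_assoc, div_le_div_iff₀ (by positivity) (by positivity)]
    have := mul_le_mul_of_nonneg_right hLC (by positivity : 0 ≤ (T : ℝ) * L)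
    linarith

end HubModel

theorem proposition1
    -- the sizes of the hub set, of the node set and of the sample
    (nL n T : ℕ → ℕ) (hle : ∀ k, nL k ≤ n k)
    (hnL : Tendsto nL atTop atTop) (hn : Tendsto n atTop atTop) (hT : Tendsto T atTop atTop)
    -- the parameters of the model
    (ρ : ∀ k, Fin (nL k) → ℝ) (A : ∀ k, Fin (nL k) → Fin (n k) → ℝ)
    (hρ : ∀ k, HubModel.IsHubDistribution (ρ k))
    (hA : ∀ k, HubModel.IsLinkMatrix (hle k) (A k))
    -- the sample
    {Ω : ℕ → Type*} [∀ k, MeasurableSpace (Ω k)]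
    (μ : ∀ k, Measure (Ω k)) [∀ k, IsProbabilityMeasure (μ k)]
    (Z : ∀ k, Ω k → Fin (T k) → Fin (nL k))
    (G : ∀ k, Ω k → Fin (T k) → Fin (n k) → Bool)
    (hZG : ∀ k, HubModel.IsSample (μ k) (ρ k) (A k) (Z k) (G k))
    -- the maximum profile likelihood estimator
    (zhat : ∀ k, Ω k → Fin (T k) → Fin (nL k))
    (hzhat : ∀ k, ∀ᵐ ω ∂(μ k), HubModel.IsMaxProfileLik (hle k) (G k ω) (zhat k ω))
    -- hub probabilities of the order `1 / nL`
    (cmin cmax : ℝ) (hcmin : 0 < cmin)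
    (hρ_bounds : ∀ k i, cmin / (nL k : ℝ) ≤ ρ k i ∧ ρ k i ≤ cmax / (nL k : ℝ))
    -- separation of the hubs
    (d v : ℕ → ℝ) (hd : ∀ k, 0 < d k) (hv : ∀ k, 0 < v k)
    (hsep : ∀ k, HubModel.Separated (A k) (d k) (v k))
    -- links between leaders
    (c₀ : ℝ) (hc₀ : 0 < c₀)
    (hlead : ∀ k, ∀ i i' : Fin (nL k), i ≠ i' →
      A k i (Fin.castLE (hle k) i') ≤ c₀ / (nL k : ℝ))
    -- rates
    (hrate₁ : Tendsto (fun k => (nL k : ℝ) ^ 2 * Real.log (nL k) / (T k : ℝ)) atTop (𝓝 0))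
    (hrate₂ : Tendsto (fun k => (nL k : ℝ) ^ 3 * Real.log (T k) / (d k ^ 2 * v k * (T k : ℝ)))
      atTop (𝓝 0))
    (hrate₃ : Tendsto
      (fun k => (nL k : ℝ) ^ 4 * Real.log (nL k) / (d k ^ 4 * v k ^ 2 * (n k : ℝ)))
      atTop (𝓝 0)) :
    ∀ ε : ℝ, 0 < ε →
      Tendsto
        (fun k => μ k {ω | ε ≤ (nL k : ℝ) *
          ((HubModel.numErrors (Z k ω) (zhat k ω) : ℝ) / (T k : ℝ))})
        atTop (𝓝 0) := by

  intro ε hε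
  have hLR : Tendsto (fun k => (nL k : ℝ)) atTop atTop := tendsto_natCast_atTop_atTop.comp hnL
  have hlim : Tendsto (fun k => ENNReal.ofReal (3 / (nL k : ℝ))) atTop (𝓝 0) := by
    simpa using ENNReal.tendsto_ofReal (hLR.const_div_atTop 3)
  -- Each of the three failure probabilities is eventually at most `1 / nL k`, so the bound `3 / nL
  -- k` tends to zero.
  refine tendsto_of_tendsto_of_tendsto_of_le_of_le' tendsto_const_nhds hlim
    (Eventually.of_forall fun _ => zero_le) ?_
  filter_upwards [hnL.eventually_ge_atTop 2, hT.eventually_ge_atTop 2,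
    hLR.eventually_ge_atTop (8 * (2 * (cmax * c₀) + 1) / cmin),
    hrate₁.eventually_le_const (by positivity : 0 < cmin / 8),
    hrate₁.eventually_le_const (by norm_num : (0 : ℝ) < 1 / 3),
    hrate₂.eventually_le_const (by positivity : 0 < ε / 96),
    hrate₃.eventually_le_const (by positivity : 0 < ε / 48)] with k kL kT kC k1 k1' k2 k3
  exact (hZG k).measure_numErrors_ge_le_three_div (hρ k) (hA k) (hzhat k) hcmin (hρ_bounds k)
    (hd k) (hv k) (hsep k) (hlead k) hε kL kC kT k1 k1' k2 k3
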